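/- Let $k$ be a field and let $\mathsf{Ch}_{\mathrm{fin}}$ be the full subcategory of the category of non-negatively graded chain complexes of $k$-vector spaces consisting of the complexes that are finite-dimensional in each degree. Let $\mathcal C$ be the class of degreewise monomorphisms, $\mathcal F$ the class of chain maps that are surjective in every positive degree, and $\mathcal W$ the class of quasi-isomorphisms in $\mathsf{Ch}_{\mathrm{fin}}$. Let $S^n$ ($n\ge 0$) be the complex with $k$ in degree $n$ and $0$ elsewhere, let $D^n$ ($n\ge 1$) be the complex with $k$ in degrees $n$ and $n-1$, differential $\mathrm{id}_k$ between them, and $0$ elsewhere, and let $D^n\to S^n$ be the identity of $k$ in degree $n$. Put $$\mathcal X=\{D^n\to S^n\}_{n\ge1}\cup\{0\to S^0\},\qquad \mathcal Z=\{D^n\to 0\}_{n\ge1}.$$ For a class $\mathcal P$ of morphisms in $\mathsf{Ch}_{\mathrm{fin}}$, a $\mathcal P$-Postnikov tower is a morphism of the form $\lim_{\beta<\lambda}Y^\beta\to Y^0$, where $\lambda$ is a nonzero ordinal and $Y\colon\lambda^{\mathrm{op}}\to\mathsf{Ch}_{\mathrm{fin}}$ is a functor such that $Y^{\beta+1}\to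 Y^\beta$ is a pullback of a morphism of $\mathcal P$ whenever $\beta+1<\lambda$, and $Y^\gamma=\lim_{\beta<\gamma}Y^\beta$ for every limit ordinal $\gamma<\lambda$; these limits and pullbacks are taken in $\mathsf{Ch}_{\mathrm{fin}}$, and only those that occur are required to exist. **Theorem 3.1.** With cofibrations $\mathcal C$, fibrations $\mathcal F$ and weak equivalences $\mathcal W$, the category $\mathsf{Ch}_{\mathrm{fin}}$ is a model category (in the sense that requires only finite limits and colimits), and $(\mathcal X,\mathcal Z)$ is a Postnikov presentation of it. That is, $(\mathcal C\cap\mathcal W,\mathcal F)$ and $(\mathcal C,\mathcal F\cap\mathcal W)$ are weak factorization systems, $\mathcal F$ is exactly the class of retracts of $\mathcal X$-Postnikov towers, and $\mathcal F\cap\mathcal W$ is exactly the class of retracts of $\mathcal Z$-Postnikov towers. -/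

import Mathlib

open CategoryTheory Limits HomotopicalAlgebra

universe w v u

noncomputable section

namespace Postnikov

section General

variable {C : Type u} [Category.{v} C]

/-- The class of `P`-Postnikov towers. A well-ordered tower `Y : λᵒᵖ ⥤ C` is read as a functor
from the well-ordered set `λ` to `Cᵒᵖ`: each `Y^(β+1) ⟶ Y^β` is a pullback in `C` of a single map
of `P`, `Y^γ` is the limit of the `Y^β` with `β < γ` at each limit element `γ` of `λ`, and the
Postnikov tower is the map from the limit of the whole tower to `Y^0`. All pullbacks and limits are
those of `C`, and only those that occur are required to exist. -/
def towers (P : MorphismProperty C) : MorphismProperty C :=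
  (MorphismProperty.transfiniteCompositions.{w} P.pullbacks.op).unop

/-- A Postnikov presentation of a weak factorization system `(L, R)`: the right class consists
exactly of the retracts of `P`-Postnikov towers. -/
structure IsPresentation (L R P : MorphismProperty C) : Prop where
  isWeakFactorizationSystem : L.IsWeakFactorizationSystem R
  eq_retracts : R = (towers.{w} P).retracts

variable (C) in
/-- A Postnikov presentation `(X, Z)` of a model category. -/
structure IsModelPresentation [ModelCategory C] (X Z : MorphismProperty C) : Prop where
  fibrations : IsPresentation.{w} (trivialCofibrations C) (fibrations C) X
  trivialFibrations : IsPresentation.{w} (cofibrations C) (trivialFibrations C) Z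

end General

section Chains

variable (k : Type u) [Field k]

/-- Non-negatively graded chain complexes of `k`-vector spaces of finite dimension in each
degree. -/
def degreewiseFinite : ObjectProperty (ChainComplex (ModuleCat.{u} k) ℕ) :=
  fun K ↦ ∀ n, Module.Finite k (K.X n)

/-- The full subcategory of degreewise finite-dimensional chain complexes. -/
abbrev ChFin : Type (u + 1) := (degreewiseFinite k).FullSubcategory

/-- Degreewise monomorphisms. -/
def cof : MorphismProperty (ChFin k) :=
  fun _ _ f ↦ ∀ n, Function.Injective (f.hom.f n)

/-- Maps that are surjective in all positive degrees. -/
def fib : MorphismProperty (ChFin k) :=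
  fun _ _ f ↦ ∀ n, 0 < n → Function.Surjective (f.hom.f n)

/-- Quasi-isomorphisms. -/
def weq : MorphismProperty (ChFin k) :=
  fun _ _ f ↦ QuasiIso f.hom

/-- The zero complex. -/
abbrev zeroCx : ChFin k where
  obj := HomologicalComplex.zero
  property n := by
    have := ModuleCat.subsingleton_of_isZero
      ((HomologicalComplex.eval (ModuleCat.{u} k) (ComplexShape.down ℕ) n).map_isZero
        HomologicalComplex.isZero_zero)
    exact inferInstanceAs (Module.Finite k ((HomologicalComplex.eval (ModuleCat.{u} k)
      (ComplexShape.down ℕ) n).obj HomologicalComplex.zero))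

/-- The complex with the field `k` in degree `n`, and zero elsewhere. -/
abbrev sphereCx (n : ℕ) : ChainComplex (ModuleCat.{u} k) ℕ :=
  (HomologicalComplex.single (ModuleCat.{u} k) (ComplexShape.down ℕ) n).obj (ModuleCat.of k k)

/-- The sphere `S^n`. -/
abbrev sphere (n : ℕ) : ChFin k where
  obj := sphereCx k n
  property m := by
    by_cases h : m = n
    · subst h
      exact Module.Finite.equiv (HomologicalComplex.singleObjXSelf
        (ComplexShape.down ℕ) m (ModuleCat.of k k)).symm.toLinearEquiv
    · have := ModuleCat.subsingleton_of_isZero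
        (HomologicalComplex.isZero_single_obj_X (ComplexShape.down ℕ) n (ModuleCat.of k k) m h)
      infer_instance

lemma down_rel (n : ℕ) : (ComplexShape.down ℕ).Rel (n + 1) n := by simp

/-- The complex consisting of the identity of `k` from degree `n + 1` to degree `n`, and zero
elsewhere. -/
abbrev discCx (n : ℕ) : ChainComplex (ModuleCat.{u} k) ℕ :=
  HomologicalComplex.double (𝟙 (ModuleCat.of k k)) (down_rel n)

/-- The disc `D^(n+1)`. -/
abbrev disc (n : ℕ) : ChFin k where
  obj := discCx k n
  property m := by
    by_cases h₀ : m = n + 1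
    · subst h₀
      exact Module.Finite.equiv (HomologicalComplex.doubleXIso₀ (𝟙 (ModuleCat.of k k))
        (down_rel n)).symm.toLinearEquiv
    · by_cases h₁ : m = n
      · subst h₁
        exact Module.Finite.equiv (HomologicalComplex.doubleXIso₁ (𝟙 (ModuleCat.of k k))
          (down_rel m) (by simp)).symm.toLinearEquiv
      · have := ModuleCat.subsingleton_of_isZero
          (HomologicalComplex.isZero_double_X (𝟙 (ModuleCat.of k k)) (down_rel n) m h₀ h₁)
        infer_instance

/-- The chain map that is the identity of `k` in degree `n + 1`. -/
def discCxToSphereCx (n : ℕ) : discCx k n ⟶ sphereCx k (n + 1) :=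
  HomologicalComplex.mkHomToSingle
    (HomologicalComplex.doubleXIso₀ (𝟙 (ModuleCat.of k k)) (down_rel n)).hom
    (fun i hi ↦ by
      have hi' : n + 1 + 1 = i := by simpa using hi
      rw [HomologicalComplex.double_d_eq_zero₀ _ _ _ _ (by omega), zero_comp])

/-- The map `D^(n+1) ⟶ S^(n+1)`. -/
def discToSphere (n : ℕ) : disc k n ⟶ sphere k (n + 1) :=
  ObjectProperty.homMk (discCxToSphereCx k n)

/-- The generating fibrations `D^n ⟶ S^n` for `n ≥ 1`, and `0 ⟶ S^0`. -/
inductive genFib : MorphismProperty (ChFin k)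
  | disc (n : ℕ) : genFib (discToSphere k n)
  | zero : genFib (ObjectProperty.homMk 0 : zeroCx k ⟶ sphere k 0)

/-- The generating acyclic fibrations `D^n ⟶ 0` for `n ≥ 1`. -/
inductive genTrivFib : MorphismProperty (ChFin k)
  | disc (n : ℕ) : genTrivFib (ObjectProperty.homMk 0 : disc k n ⟶ zeroCx k)

end Chains

end Postnikov

end

noncomputable section

/-! ### Finite limits, and homology in terms of elements -/

namespace Postnikov

variable (k : Type u) [Field k]

/-! Everything reduces to linear forms over a field. A map into `D^(n+1)` is a linear form on degree
`n`, and a map into `S^n` is a form on degree `n` that vanishes on boundaries. Hence lifting against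
a generator is a problem of extending forms (`genTrivFib_le_rlp`, `genFib_le_rlp`), and the lifting
property passes to towers and their retracts. Both factorizations come from a product with an
acyclic sum of discs.

It remains to exhibit each (acyclic) fibration `E ⟶ B` as a retract of a tower. Starting from the
given map, the target is repeatedly modified by a pullback of one generator, at the lowest degree
where the map from `E` is not yet bijective (`hasImprovements_fib`, `hasImprovements_trivFib`).
Dimensions are finite, so a numerical complexity shows that each degree becomes bijective after
finitely many steps. In each degree the tower is therefore eventually constant with value that of
`E`, so its limit exists in `ChFin k` and is `E`, although infinite limits need not exist there in
general.

The process must not stop if the tower is to be indexed by `ℕ`. This is ensured by first multiplying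
`E` by one disc of every dimension, which only replaces the map by one of which it is a retract
(`HasImprovements.le_retracts_towers`). -/

instance (J : Type) [SmallCategory J] [FinCategory J] :
    (degreewiseFinite k).IsClosedUnderLimitsOfShape J where
  limitsOfShape_le := by
    rintro K ⟨p⟩ n
    let F := p.diag ⋙ HomologicalComplex.eval (ModuleCat.{u} k) (ComplexShape.down ℕ) n
    have : ∀ j, Module.Finite k (F.obj j) := fun j ↦ p.prop_diag_obj j n
    -- A finite limit embeds in the product of its finitely many terms; dually, a finite colimit is
    -- a quotient of a finite sum.
    have : Module.Finite k (limit F : ModuleCat.{u} k) :=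
      Module.Finite.of_injective (limitSubobjectProduct F).hom
        ((ModuleCat.mono_iff_injective _).1 inferInstance)
    refine (Module.Finite.equiv_iff (IsLimit.conePointUniqueUpToIso (limit.isLimit F)
      (isLimitOfPreserves (HomologicalComplex.eval (ModuleCat.{u} k) (ComplexShape.down ℕ) n)
        p.isLimit)).toLinearEquiv).1 this

instance (J : Type) [SmallCategory J] [FinCategory J] :
    (degreewiseFinite k).IsClosedUnderColimitsOfShape J where
  colimitsOfShape_le := by
    rintro K ⟨p⟩ n
    let F := p.diag ⋙ HomologicalComplex.eval (ModuleCat.{u} k) (ComplexShape.down ℕ) n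
    have : ∀ j, Module.Finite k (F.obj j) := fun j ↦ p.prop_diag_obj j n
    have : Module.Finite k (colimit F : ModuleCat.{u} k) :=
      Module.Finite.of_surjective (colimitQuotientCoproduct F).hom
        ((ModuleCat.epi_iff_surjective _).1 inferInstance)
    refine (Module.Finite.equiv_iff (IsColimit.coconePointUniqueUpToIso (colimit.isColimit F)
      (isColimitOfPreserves (HomologicalComplex.eval (ModuleCat.{u} k) (ComplexShape.down ℕ) n)
        p.isColimit)).toLinearEquiv).1 this

instance : HasFiniteLimits (ChFin k) where
  out _ _ _ := inferInstance

instance : HasFiniteColimits (ChFin k) where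
  out _ _ _ := inferInstance

variable {k}

instance (K : ChFin k) (n : ℕ) : Module.Finite k (K.obj.X n) := K.property n

variable (k) in
/-- The functor sending a complex to its component of degree `n`. -/
abbrev evalDeg (n : ℕ) : ChFin k ⥤ ModuleCat.{u} k :=
  (degreewiseFinite k).ι ⋙ HomologicalComplex.eval (ModuleCat.{u} k) (ComplexShape.down ℕ) n

section Pullback

variable {P Y D S : ChFin k} {fst : P ⟶ Y} {snd : P ⟶ D} {h : Y ⟶ S} {c : D ⟶ S}

lemma isPullback_evalDeg (sq : IsPullback fst snd h c) (n : ℕ) :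
    IsPullback (fst.hom.f n) (snd.hom.f n) (h.hom.f n) (c.hom.f n) :=
  sq.map (evalDeg k n)

lemma exists_of_isPullback (sq : IsPullback fst snd h c) {n : ℕ}
    (y : Y.obj.X n) (d : D.obj.X n) (hyd : h.hom.f n y = c.hom.f n d) :
    ∃ p : P.obj.X n, fst.hom.f n p = y ∧ snd.hom.f n p = d :=
  Types.exists_of_isPullback ((isPullback_evalDeg sq n).map (forget _)) y d hyd

lemma ext_of_isPullback (sq : IsPullback fst snd h c) {n : ℕ} {p p' : P.obj.X n}
    (h₁ : fst.hom.f n p = fst.hom.f n p') (h₂ : snd.hom.f n p = snd.hom.f n p') : p = p' :=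
  Types.ext_of_isPullback ((isPullback_evalDeg sq n).map (forget _)) h₁ h₂

end Pullback

lemma comm_apply {K L : ChFin k} (f : K ⟶ L) (i j : ℕ) (x : K.obj.X i) :
    f.hom.f j (K.obj.d i j x) = L.obj.d i j (f.hom.f i x) :=
  (ConcreteCategory.congr_hom (f.hom.comm i j) x).symm

lemma d_d_apply (K : ChFin k) (i j l : ℕ) (x : K.obj.X i) :
    K.obj.d j l (K.obj.d i j x) = 0 :=
  ConcreteCategory.congr_hom (K.obj.d_comp_d i j l) x

/-- A chain map induces a bijection in homology, expressed with elements. -/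
structure BijOnHomology {K L : ChFin k} (f : K ⟶ L) : Prop where
  inj (n : ℕ) (x : K.obj.X n) (hx : K.obj.d n (n - 1) x = 0) (y : L.obj.X (n + 1))
    (hy : L.obj.d (n + 1) n y = f.hom.f n x) : ∃ z, K.obj.d (n + 1) n z = x
  surj (n : ℕ) (y : L.obj.X n) (hy : L.obj.d n (n - 1) y = 0) :
    ∃ x z, K.obj.d n (n - 1) x = 0 ∧ f.hom.f n x + L.obj.d (n + 1) n z = y

/-- In the explicit model of homology as cycles modulo boundaries, the two clauses are the
injectivity and the surjectivity of the induced map of quotients. -/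
lemma shortComplex_quasiIso_iff {S T : ShortComplex (ModuleCat.{u} k)} (φ : S ⟶ T) :
    ShortComplex.QuasiIso φ ↔
      (∀ x : S.X₂, S.g x = 0 → ∀ y : T.X₁, T.f y = φ.τ₂ x → ∃ z, S.f z = x) ∧
      (∀ y : T.X₂, T.g y = 0 → ∃ x z, S.g x = 0 ∧ φ.τ₂ x + T.f z = y) := by
  let ψ : LinearMap.ker S.g.hom →ₗ[k] LinearMap.ker T.g.hom :=
    φ.τ₂.hom.restrict (fun x hx ↦ by
      have := ConcreteCategory.congr_hom φ.comm₂₃ x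
      simp only [LinearMap.mem_ker] at hx ⊢
      simpa [hx] using this)
  have hψ : LinearMap.range S.moduleCatToCycles ≤
      (LinearMap.range T.moduleCatToCycles).comap ψ := by
    rintro _ ⟨x, rfl⟩
    exact ⟨φ.τ₁ x, Subtype.ext (ConcreteCategory.congr_hom φ.comm₁₂ x)⟩
  let γ : ShortComplex.LeftHomologyMapData φ S.moduleCatLeftHomologyData
      T.moduleCatLeftHomologyData :=
    { φK := ModuleCat.ofHom ψ
      φH := ModuleCat.ofHom (Submodule.mapQ _ _ ψ hψ)
      commi := rfl
      commf' := by
        ext x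
        exact Subtype.ext (ConcreteCategory.congr_hom φ.comm₁₂ x).symm
      commπ := rfl }
  rw [γ.quasiIso_iff, ConcreteCategory.isIso_iff_bijective]
  change Function.Bijective (Submodule.mapQ _ _ ψ hψ) ↔ _
  refine and_congr ?_ ?_
  · rw [injective_iff_map_eq_zero]
    constructor
    · intro h x hx y hy
      have := h (Submodule.Quotient.mk ⟨x, hx⟩) (by
        rw [Submodule.mapQ_apply, Submodule.Quotient.mk_eq_zero]
        exact ⟨y, Subtype.ext hy⟩)
      rw [Submodule.Quotient.mk_eq_zero] at this
      obtain ⟨z, hz⟩ := this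
      exact ⟨z, congr_arg Subtype.val hz⟩
    · intro h q hq
      obtain ⟨⟨x, hx⟩, rfl⟩ := Submodule.Quotient.mk_surjective _ q
      rw [Submodule.mapQ_apply, Submodule.Quotient.mk_eq_zero] at hq
      obtain ⟨y, hy⟩ := hq
      obtain ⟨z, hz⟩ := h x hx y (congr_arg Subtype.val hy)
      rw [Submodule.Quotient.mk_eq_zero]
      exact ⟨z, Subtype.ext hz⟩
  · constructor
    · intro h y hy
      obtain ⟨q, hq⟩ := h (Submodule.Quotient.mk ⟨y, hy⟩)
      obtain ⟨⟨x, hx⟩, rfl⟩ := Submodule.Quotient.mk_surjective _ q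
      rw [Submodule.mapQ_apply, eq_comm, Submodule.Quotient.eq] at hq
      obtain ⟨z, hz⟩ := hq
      have hz' : T.f z = y - φ.τ₂ x := congr_arg Subtype.val hz
      exact ⟨x, z, hx, by rw [hz']; abel⟩
    · intro h q
      obtain ⟨⟨y, hy⟩, rfl⟩ := Submodule.Quotient.mk_surjective _ q
      obtain ⟨x, z, hx, hz⟩ := h y hy
      refine ⟨Submodule.Quotient.mk ⟨x, hx⟩, ?_⟩
      rw [Submodule.mapQ_apply, eq_comm, Submodule.Quotient.eq]
      refine ⟨z, Subtype.ext ?_⟩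
      change T.f z = y - φ.τ₂ x
      rw [← hz]; abel

/-- The truncated `n - 1` is harmless: for `n = 0` the differential from degree `0` to degree `0`
vanishes, so every element counts as a cycle. -/
lemma weq_iff {K L : ChFin k} (f : K ⟶ L) : weq k f ↔ BijOnHomology f := by
  have key (n : ℕ) : QuasiIsoAt f.hom n ↔ _ :=
    (quasiIsoAt_iff' f.hom (n + 1) n (n - 1) (by simp) (by cases n <;> simp)).trans
      (shortComplex_quasiIso_iff _)
  change QuasiIso f.hom ↔ _
  rw [quasiIso_iff]
  simp only [key]
  exact ⟨fun h ↦ ⟨fun n ↦ (h n).1, fun n ↦ (h n).2⟩, fun h n ↦ ⟨h.1 n, h.2 n⟩⟩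

instance : (weq k).HasTwoOutOfThreeProperty :=
  inferInstanceAs ((HomologicalComplex.quasiIso (ModuleCat.{u} k)
    (ComplexShape.down ℕ)).inverseImage (degreewiseFinite k).ι).HasTwoOutOfThreeProperty

instance : (weq k).IsStableUnderRetracts :=
  inferInstanceAs ((HomologicalComplex.quasiIso (ModuleCat.{u} k)
    (ComplexShape.down ℕ)).inverseImage (degreewiseFinite k).ι).IsStableUnderRetracts

lemma comp_apply {K L M : ChFin k} (f : K ⟶ L) (g : L ⟶ M) (n : ℕ) (x : K.obj.X n) :
    (f ≫ g).hom.f n x = g.hom.f n (f.hom.f n x) := rfl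

lemma comp_eq_apply {K L M : ChFin k} {f : K ⟶ L} {g : L ⟶ M} {h : K ⟶ M} (e : f ≫ g = h)
    (n : ℕ) (x : K.obj.X n) : g.hom.f n (f.hom.f n x) = h.hom.f n x := by
  rw [← e, comp_apply]

instance : (cof k).IsStableUnderRetracts where
  of_retract {X Y Z W f g} r hg n := by
    have : Function.Injective ((r.i.left ≫ g).hom.f n) := by
      refine (hg n).comp (Function.LeftInverse.injective (g := r.r.left.hom.f n) fun x ↦ ?_)
      exact comp_eq_apply r.retract_left n x
    rw [r.i_w] at this
    exact Function.Injective.of_comp this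

instance : (fib k).IsStableUnderRetracts where
  of_retract {X Y Z W f g} r hg n hn := by
    have : Function.Surjective ((g ≫ r.r.right).hom.f n) := by
      refine Function.Surjective.comp (g := r.r.right.hom.f n)
        (Function.RightInverse.surjective (g := r.i.right.hom.f n) fun x ↦ ?_) (hg n hn)
      exact comp_eq_apply r.retract_right n x
    rw [← r.r_w] at this
    exact Function.Surjective.of_comp this

end Postnikov

/-! ### Lifting properties of the generators and acyclicity of discs -/

namespace Postnikov

/-- In the opposite category a tower is a transfinite composition of pushouts, and a left lifting
class is closed under both operations. -/
lemma towers_le_rlp {C : Type u} [Category.{v} C] {P T : MorphismProperty C} (h : P ≤ T.rlp) :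
    towers.{w} P ≤ T.rlp := by
  have h' : P.pullbacks.op ≤ T.op.llp := fun X Y f hf _ _ g hg ↦ by
    have : T.rlp f.unop := T.rlp.isStableUnderBaseChange_iff_pullbacks_le.1 inferInstance _
      (MorphismProperty.pullbacks_monotone h _ hf)
    exact (HasLiftingProperty.iff_unop _ _).2 (this _ hg)
  intro X Y f hf A B g hg
  exact HasLiftingProperty.iff_op.2
    (MorphismProperty.transfiniteCompositions_le_iff.{w}.2 h' _ hf g.op hg)

variable {k : Type u} [Field k]

/-- The range of a dual map is the annihilator of the kernel. All extensions of linear forms below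
come from this. -/
lemma exists_factor {M N : Type*} [AddCommGroup M] [Module k M] [AddCommGroup N] [Module k N]
    (L : M →ₗ[k] N) (f : M →ₗ[k] k) (h : ∀ x, L x = 0 → f x = 0) :
    ∃ g : N →ₗ[k] k, ∀ x, g (L x) = f x := by
  have : f ∈ LinearMap.range L.dualMap := by
    rw [LinearMap.range_dualMap_eq_dualAnnihilator_ker, Submodule.mem_dualAnnihilator]
    exact h
  obtain ⟨g, hg⟩ := this
  exact ⟨g, fun x ↦ LinearMap.congr_fun hg x⟩

variable (k) in
/-- The component of degree `n + 1` of the disc. -/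
def discTop (n : ℕ) : (disc k n).obj.X (n + 1) ≃ₗ[k] k :=
  (HomologicalComplex.doubleXIso₀ (𝟙 (ModuleCat.of k k)) (down_rel n)).toLinearEquiv

variable (k) in
/-- The component of degree `n` of the disc. -/
def discBot (n : ℕ) : (disc k n).obj.X n ≃ₗ[k] k :=
  (HomologicalComplex.doubleXIso₁ (𝟙 (ModuleCat.of k k)) (down_rel n) (by simp)).toLinearEquiv

variable (k) in
/-- The component of degree `n` of the sphere. -/
def sphereCoord (n : ℕ) : (sphere k n).obj.X n ≃ₗ[k] k :=
  (HomologicalComplex.singleObjXSelf (ComplexShape.down ℕ) n (ModuleCat.of k k)).toLinearEquiv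

lemma discBot_d (n : ℕ) (x : (disc k n).obj.X (n + 1)) :
    discBot k n ((disc k n).obj.d (n + 1) n x) = discTop k n x := by
  have := HomologicalComplex.double_d (𝟙 (ModuleCat.of k k)) (down_rel n) (by simp)
  refine (congr_arg (discBot k n) (ConcreteCategory.congr_hom this x)).trans ?_
  exact (discBot k n).apply_symm_apply _

lemma subsingleton_disc {n i : ℕ} (h₀ : i ≠ n + 1) (h₁ : i ≠ n) :
    Subsingleton ((disc k n).obj.X i) :=
  ModuleCat.subsingleton_of_isZero (HomologicalComplex.isZero_double_X _ (down_rel n) i h₀ h₁)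

lemma subsingleton_sphere {n i : ℕ} (h : i ≠ n) : Subsingleton ((sphere k n).obj.X i) :=
  ModuleCat.subsingleton_of_isZero (HomologicalComplex.isZero_single_obj_X _ n _ i h)

lemma subsingleton_zeroCx (i : ℕ) : Subsingleton ((zeroCx k).obj.X i) :=
  ModuleCat.subsingleton_of_isZero
    ((HomologicalComplex.eval (ModuleCat.{u} k) (ComplexShape.down ℕ) i).map_isZero
      HomologicalComplex.isZero_zero)

lemma sphereCoord_discToSphere (n : ℕ) (x : (disc k n).obj.X (n + 1)) :
    sphereCoord k (n + 1) ((discToSphere k n).hom.f (n + 1) x) = discTop k n x := by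
  have : (discToSphere k n).hom.f (n + 1) = _ :=
    HomologicalComplex.mkHomToSingle_f (K := discCx k n) (A := ModuleCat.of k k) _ (fun i hi ↦ by
      rw [HomologicalComplex.double_d_eq_zero₁ _ _ _ _ (by simp), zero_comp])
  refine (congr_arg (sphereCoord k (n + 1)) (ConcreteCategory.congr_hom this x)).trans ?_
  exact (sphereCoord k (n + 1)).apply_symm_apply _

section

variable {K : ChFin k} {n : ℕ}

/-- The map to a disc given by a linear form. -/
def toDisc (φ : K.obj.X n →ₗ[k] k) : K ⟶ disc k n :=
  ObjectProperty.homMk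
    { f i :=
        if h₀ : i = n + 1 then
          ModuleCat.ofHom ((discTop k n).symm.toLinearMap ∘ₗ φ ∘ₗ (K.obj.d (n + 1) n).hom ∘ₗ
            (K.obj.XIsoOfEq h₀).hom.hom) ≫ ((disc k n).obj.XIsoOfEq h₀).inv
        else if h₁ : i = n then
          ModuleCat.ofHom ((discBot k n).symm.toLinearMap ∘ₗ φ ∘ₗ
            (K.obj.XIsoOfEq h₁).hom.hom) ≫ ((disc k n).obj.XIsoOfEq h₁).inv
        else 0
      comm' i j hij := by
        obtain rfl : j + 1 = i := hij
        by_cases hj : j = n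
        · subst hj
          ext x
          apply (discBot k j).injective
          simp only [HomologicalComplex.XIsoOfEq]
          simp
          exact (discBot_d _ _).trans (LinearEquiv.apply_symm_apply _ _)
        · by_cases hj' : j = n + 1
          · subst hj'
            ext x
            rw [dif_neg (by omega), dif_neg (by omega)]
            simp [HomologicalComplex.XIsoOfEq]
          · have := subsingleton_disc (k := k) hj' hj
            ext x
            exact Subsingleton.elim _ _ }

@[simp]
lemma discBot_toDisc (φ : K.obj.X n →ₗ[k] k) (x : K.obj.X n) :
    discBot k n ((toDisc φ).hom.f n x) = φ x := by
  simp [toDisc, HomologicalComplex.XIsoOfEq]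

lemma discTop_eq (f : K ⟶ disc k n) (x : K.obj.X (n + 1)) :
    discTop k n (f.hom.f (n + 1) x) = discBot k n (f.hom.f n (K.obj.d (n + 1) n x)) := by
  rw [comm_apply, discBot_d]

/-- The component in degree `n + 1` is forced by the one in degree `n`, because the differential of
the disc is bijective. -/
lemma toDisc_ext {f g : K ⟶ disc k n}
    (h : ∀ x, discBot k n (f.hom.f n x) = discBot k n (g.hom.f n x)) : f = g := by
  apply ObjectProperty.hom_ext
  apply HomologicalComplex.to_double_hom_ext (hi₀₁ := down_rel n)
  · ext x
    apply (discTop k n).injective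
    exact (discTop_eq f x).trans ((h _).trans (discTop_eq g x).symm)
  · ext x
    exact (discBot k n).injective (h x)

/-- The map to a sphere given by a linear form which vanishes on boundaries. -/
def toSphere (ψ : K.obj.X n →ₗ[k] k) (hψ : ∀ x, ψ (K.obj.d (n + 1) n x) = 0) : K ⟶ sphere k n :=
  ObjectProperty.homMk (HomologicalComplex.mkHomToSingle (ModuleCat.ofHom ψ) (by
    rintro i hi
    obtain rfl : n + 1 = i := hi
    ext x
    exact hψ x))

@[simp]
lemma sphereCoord_toSphere (ψ : K.obj.X n →ₗ[k] k) (hψ : ∀ x, ψ (K.obj.d (n + 1) n x) = 0)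
    (x : K.obj.X n) : sphereCoord k n ((toSphere ψ hψ).hom.f n x) = ψ x := by
  have : (toSphere ψ hψ).hom.f n = _ :=
    HomologicalComplex.mkHomToSingle_f (ModuleCat.ofHom ψ) (by
      rintro i rfl
      ext x
      exact hψ x)
  refine (congr_arg (sphereCoord k n) (ConcreteCategory.congr_hom this x)).trans ?_
  exact (sphereCoord k n).apply_symm_apply _

lemma toSphere_ext {f g : K ⟶ sphere k n}
    (h : ∀ x, sphereCoord k n (f.hom.f n x) = sphereCoord k n (g.hom.f n x)) : f = g := by
  apply ObjectProperty.hom_ext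
  apply HomologicalComplex.to_single_hom_ext
  ext x
  exact (sphereCoord k n).injective (h x)

lemma sphere_apply_d (f : K ⟶ sphere k n) (x : K.obj.X (n + 1)) :
    f.hom.f n (K.obj.d (n + 1) n x) = 0 := by
  have := subsingleton_sphere (k := k) (n.succ_ne_self)
  rw [comm_apply, Subsingleton.elim (f.hom.f (n + 1) x) 0, map_zero]

end

lemma hom_ext_of_subsingleton {K L : ChFin k} (h : ∀ i, Subsingleton (L.obj.X i)) (f g : K ⟶ L) :
    f = g := by
  apply ObjectProperty.hom_ext
  ext i x
  exact Subsingleton.elim _ _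

lemma genTrivFib_le_rlp : genTrivFib k ≤ (cof k).rlp := by
  rintro _ _ _ ⟨n⟩ A B i hi
  refine ⟨fun {f g} sq ↦ ?_⟩
  obtain ⟨φ, hφ⟩ := exists_factor (i.hom.f n).hom
    ((discBot k n).toLinearMap ∘ₗ (f.hom.f n).hom) (fun x hx ↦ by
      rw [hi n (hx.trans (map_zero (i.hom.f n).hom).symm), map_zero])
  exact ⟨⟨⟨toDisc φ, toDisc_ext fun x ↦ (discBot_toDisc _ _).trans (hφ x),
    hom_ext_of_subsingleton subsingleton_zeroCx _ _⟩⟩⟩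

/-- For a disc over a sphere, a lift is a form on `B` in degree `n` with prescribed composites with
`i` and with the differential. It exists once the prescribed values agree on the kernel of `(i, d)`,
and this is where the homology of `i` enters. For `0 ⟶ S^0`, surjectivity on homology in degree `0`
forces `g` to vanish. -/
lemma genFib_le_rlp : genFib k ≤ (cof k ⊓ weq k).rlp := by
  rintro _ _ _ hp A B i ⟨hi, hw⟩
  rw [weq_iff] at hw
  refine ⟨fun {f g} sq ↦ ?_⟩
  cases hp with
  | disc n =>
    have sq' (x) : sphereCoord k (n + 1) (g.hom.f (n + 1) (i.hom.f (n + 1) x)) =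
        discBot k n (f.hom.f n (A.obj.d (n + 1) n x)) := by
      rw [← discTop_eq, ← sphereCoord_discToSphere]
      exact congr_arg _ (comp_eq_apply sq.w.symm (n + 1) x)
    obtain ⟨φ, hφ⟩ := exists_factor ((i.hom.f n).hom.coprod (B.obj.d (n + 1) n).hom)
      (((discBot k n).toLinearMap ∘ₗ (f.hom.f n).hom).coprod
        ((sphereCoord k (n + 1)).toLinearMap ∘ₗ (g.hom.f (n + 1)).hom)) (by
      rintro ⟨a, b⟩ hab
      -- Here `a` is a cycle whose image bounds, so `a = d z`. Then `i z + b` is a cycle, equal to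
      -- `i x + d v` with `x` a cycle, and the form is evaluated on `b = i x + d v - i z`.
      replace hab : i.hom.f n a + B.obj.d (n + 1) n b = 0 := hab
      change discBot k n (f.hom.f n a) + sphereCoord k (n + 1) (g.hom.f (n + 1) b) = 0
      have ha : A.obj.d n (n - 1) a = 0 := hi (n - 1) (by
        rw [comm_apply, eq_neg_of_add_eq_zero_left hab, map_neg, d_d_apply, neg_zero, map_zero])
      obtain ⟨z, rfl⟩ := hw.inj n a ha (-b) (by
        rw [map_neg, eq_neg_of_add_eq_zero_left hab])
      obtain ⟨x, v, hx, hv⟩ := hw.surj (n + 1) (i.hom.f (n + 1) z + b) (by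
        rw [map_add, Nat.add_sub_cancel, ← comm_apply, hab])
      have hb : b = i.hom.f (n + 1) x + B.obj.d (n + 1 + 1) (n + 1) v - i.hom.f (n + 1) z := by
        rw [hv]; abel
      rw [Nat.add_sub_cancel] at hx
      rw [hb, map_sub, map_add, sphere_apply_d, add_zero, map_sub, sq', sq', hx]
      simp)
    refine ⟨⟨⟨toDisc φ, toDisc_ext fun x ↦ ?_, toSphere_ext fun x ↦ ?_⟩⟩⟩
    · refine (discBot_toDisc _ _).trans ?_
      have := hφ (x, 0)
      simp only [LinearMap.coprod_apply, map_zero, add_zero] at this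
      exact this
    · rw [comp_apply, sphereCoord_discToSphere, discTop_eq, discBot_toDisc]
      simpa using hφ (0, x)
  | zero =>
    refine ⟨⟨⟨ObjectProperty.homMk 0, hom_ext_of_subsingleton subsingleton_zeroCx _ _,
      toSphere_ext fun y ↦ ?_⟩⟩⟩
    obtain ⟨x, z, -, rfl⟩ := hw.surj 0 y (by simp)
    have h₀ : g.hom.f 0 (i.hom.f 0 x) = 0 := by
      exact (comp_eq_apply sq.w.symm 0 x).trans rfl
    rw [map_add (g.hom.f 0).hom, sphere_apply_d, h₀, add_zero]
    rfl

/-- Exactness in all degrees, expressed with elements. -/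
def IsAcyclic (K : ChFin k) : Prop :=
  ∀ (n : ℕ) (x : K.obj.X n), K.obj.d n (n - 1) x = 0 → ∃ y, K.obj.d (n + 1) n y = x

lemma isAcyclic_disc (n : ℕ) : IsAcyclic (disc k n) := by
  intro i x hx
  by_cases hi : i = n
  · subst hi
    refine ⟨(discTop k i).symm (discBot k i x), (discBot k i).injective ?_⟩
    rw [discBot_d, LinearEquiv.apply_symm_apply]
  · refine ⟨0, ?_⟩
    rw [map_zero]
    by_cases hi' : i = n + 1
    · subst hi'
      apply (discTop k n).injective
      rw [← discBot_d, ← discBot_d, map_zero]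
      exact congr_arg (discBot k n) hx.symm
    · have := subsingleton_disc (k := k) hi' hi
      exact Subsingleton.elim _ _

section

variable {P Y D S : ChFin k} {fst : P ⟶ Y} {snd : P ⟶ D} {h : Y ⟶ S} {c : D ⟶ S}
  (sq : IsPullback fst snd h c) (hS : ∀ i, Subsingleton (S.obj.X i))

include sq hS

lemma exists_of_prod {n : ℕ} (y : Y.obj.X n) (d : D.obj.X n) :
    ∃ p : P.obj.X n, fst.hom.f n p = y ∧ snd.hom.f n p = d :=
  exists_of_isPullback sq y d (Subsingleton.elim _ _)

/-- The pullback is a product with an acyclic factor: a primitive in `D` completes one in `Y`, and a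
cycle of `Y` lifts with zero component in `D`. -/
lemma weq_of_prod (hD : IsAcyclic D) : weq k fst := by
  rw [weq_iff]
  constructor
  · intro n x hx y hy
    obtain ⟨e, he⟩ := hD n (snd.hom.f n x) (by rw [← comm_apply, hx, map_zero])
    obtain ⟨p, rfl, rfl⟩ := exists_of_prod sq hS y e
    exact ⟨p, ext_of_isPullback sq (by rw [comm_apply, hy]) (by rw [comm_apply, he])⟩
  · intro n y hy
    obtain ⟨p, rfl, hp⟩ := exists_of_prod sq hS y 0
    refine ⟨p, 0, ext_of_isPullback sq ?_ ?_, by rw [map_zero, add_zero]⟩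
    · rw [comm_apply, hy, map_zero]
    · rw [comm_apply, hp, map_zero, map_zero]

lemma fib_of_prod : fib k fst := fun _ _ y ↦ by
  obtain ⟨p, rfl, -⟩ := exists_of_prod sq hS y 0
  exact ⟨p, rfl⟩

end

end Postnikov

/-! ### The two factorizations -/

namespace Postnikov

variable {k : Type u} [Field k]

section DiscSum

variable (V : ℕ → ModuleCat.{u} k)

/-- The sequence of modules shifted up by one. -/
def shiftUp : ℕ → ModuleCat.{u} k
  | 0 => ModuleCat.of k PUnit.{u + 1}
  | n + 1 => V n

variable [∀ n, Module.Finite k (V n)]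

instance (n : ℕ) : Module.Finite k (shiftUp V n) := by
  cases n
  · exact inferInstanceAs (Module.Finite k PUnit.{u + 1})
  · exact inferInstanceAs (Module.Finite k (V _))

/-- The complex underlying `discSum`. -/
abbrev discSumCx : ChainComplex (ModuleCat.{u} k) ℕ :=
  ChainComplex.of (fun n ↦ ModuleCat.of k (V n × shiftUp V n))
    (fun n ↦ ModuleCat.ofHom (LinearMap.inl k (V n) (shiftUp V n) ∘ₗ
      LinearMap.snd k (V (n + 1)) (V n)))
    (fun n ↦ by ext x <;> rfl)

/-- The direct sum over `n` of the tensor products of the disc `D^(n+1)` with `V n`. -/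
abbrev discSum : ChFin k where
  obj := discSumCx V
  property n := inferInstanceAs (Module.Finite k (V n × shiftUp V n))

lemma discSum_d (n : ℕ) (x : V (n + 1) × V n) :
    (discSum V).obj.d (n + 1) n x = (x.2, (0 : shiftUp V n)) := by
  have := ChainComplex.of_d (fun n ↦ ModuleCat.of k (V n × shiftUp V n))
    (fun n ↦ ModuleCat.ofHom (LinearMap.inl k (V n) (shiftUp V n) ∘ₗ
      LinearMap.snd k (V (n + 1)) (V n))) n
  exact ConcreteCategory.congr_hom this x

lemma isAcyclic_discSum : IsAcyclic (discSum V) := by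
  rintro n ⟨a, b⟩ hx
  refine ⟨((0 : V (n + 1)), a), (discSum_d V n _).trans (Prod.ext rfl ?_)⟩
  cases n with
  | zero => rfl
  | succ n => exact (congr_arg Prod.fst ((discSum_d V n _).symm.trans hx)).symm

variable {V}

/-- The map to a sum of discs given by linear maps in each degree. -/
def toDiscSum {K : ChFin k} (φ : ∀ n, K.obj.X n →ₗ[k] V n) : K ⟶ discSum V :=
  ObjectProperty.homMk
    { f n := ModuleCat.ofHom ((φ n).prod (match n with
        | 0 => 0
        | n + 1 => φ n ∘ₗ (K.obj.d (n + 1) n).hom))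
      comm' i j hij := by
        obtain rfl : j + 1 = i := hij
        refine ModuleCat.hom_ext (LinearMap.ext fun x ↦ ?_)
        refine (discSum_d V j _).trans (Prod.ext rfl ?_)
        cases j with
        | zero => rfl
        | succ j => exact ((congr_arg (φ j) (d_d_apply K _ _ _ x)).trans (map_zero _)).symm }

/-- The map from a sum of discs given by linear maps in each degree. -/
def fromDiscSum {K : ChFin k} (φ : ∀ n, V n →ₗ[k] K.obj.X (n + 1)) : discSum V ⟶ K :=
  ObjectProperty.homMk
    { f n := ModuleCat.ofHom (((K.obj.d (n + 1) n).hom ∘ₗ φ n).coprod (match n with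
        | 0 => 0
        | n + 1 => φ n))
      comm' i j hij := by
        obtain rfl : j + 1 = i := hij
        refine ModuleCat.hom_ext (LinearMap.ext fun ⟨a, b⟩ ↦ ?_)
        refine (map_add (K.obj.d (j + 1) j).hom _ _).trans ?_
        refine (congr_arg₂ (· + ·) (d_d_apply K _ _ _ _) rfl).trans ((zero_add _).trans ?_)
        refine Eq.trans ?_ (congr_arg (LinearMap.coprod _ _) (discSum_d V j (a, b)).symm)
        exact ((LinearMap.coprod_apply ..).trans ((congr_arg _ (map_zero _)).trans
          (add_zero _))).symm }

lemma fromDiscSum_apply {K : ChFin k} (φ : ∀ n, V n →ₗ[k] K.obj.X (n + 1)) (n : ℕ) (x : V n) :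
    (fromDiscSum φ).hom.f (n + 1) ((0 : V (n + 1)), x) = φ n x := by
  change K.obj.d _ _ (φ (n + 1) 0) + φ n x = _
  rw [map_zero, map_zero, zero_add]

end DiscSum

/-- The zero map to the zero complex. -/
abbrev toZeroCx (K : ChFin k) : K ⟶ zeroCx k := ObjectProperty.homMk 0

variable (Y D : ChFin k)

/-- The product of two complexes. -/
abbrev prodCx : ChFin k := pullback (toZeroCx Y) (toZeroCx D)

lemma isPullback_prodCx : IsPullback (pullback.fst (toZeroCx Y) (toZeroCx D))
    (pullback.snd (toZeroCx Y) (toZeroCx D)) (toZeroCx Y) (toZeroCx D) :=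
  IsPullback.of_hasPullback _ _

variable {Y D}

/-- The map to a product with given components. -/
abbrev liftProd {K : ChFin k} (f : K ⟶ Y) (g : K ⟶ D) : K ⟶ prodCx Y D :=
  pullback.lift f g (hom_ext_of_subsingleton subsingleton_zeroCx _ _)

/-- The source embeds in the acyclic complex `discSum E.obj.X` by `x ↦ (x, d x)`; pairing this
embedding with `f` gives a monomorphism into a product that projects onto `B`. -/
instance : (cof k).HasFactorization (fib k ⊓ weq k) where
  nonempty_mapFactorizationData {E B} f := by
    let j : E ⟶ discSum E.obj.X := toDiscSum (fun n ↦ LinearMap.id)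
    have sq := isPullback_prodCx B (discSum E.obj.X)
    refine ⟨⟨_, liftProd f j, pullback.fst _ _, pullback.lift_fst _ _ _, ?_,
      fib_of_prod sq subsingleton_zeroCx,
      weq_of_prod sq subsingleton_zeroCx (isAcyclic_discSum _)⟩⟩
    intro n x y hxy
    have := congr_arg ((pullback.snd (toZeroCx B) (toZeroCx (discSum E.obj.X))).hom.f n) hxy
    rw [comp_eq_apply (pullback.lift_snd _ _ _), comp_eq_apply (pullback.lift_snd _ _ _)] at this
    exact congr_arg Prod.fst this

/-- Discs with tops indexed by the components of `B` in positive degrees map onto `B` in those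
degrees. Adding them to `E` does not change the homology. -/
instance : (cof k ⊓ weq k).HasFactorization (fib k) where
  nonempty_mapFactorizationData {E B} f := by
    let V (n : ℕ) : ModuleCat.{u} k := B.obj.X (n + 1)
    let θ : discSum V ⟶ B := fromDiscSum (fun n ↦ LinearMap.id)
    have sq := isPullback_prodCx E (discSum V)
    let i : E ⟶ prodCx E (discSum V) := liftProd (𝟙 _) 0
    have hi : i ≫ pullback.fst _ _ = 𝟙 _ := pullback.lift_fst _ _ _
    have hi' : i ≫ pullback.snd _ _ = 0 := pullback.lift_snd _ _ _
    refine ⟨⟨_, i, pullback.fst _ _ ≫ f + pullback.snd _ _ ≫ θ, ?_, ⟨?_, ?_⟩, ?_⟩⟩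
    · rw [Preadditive.comp_add, reassoc_of% hi, reassoc_of% hi', zero_comp, add_zero]
    · intro n
      exact Function.LeftInverse.injective fun x ↦ comp_eq_apply hi n x
    · refine (weq k).of_postcomp _ _ (weq_of_prod sq subsingleton_zeroCx (isAcyclic_discSum V)) ?_
      rw [hi, weq_iff]
      exact ⟨fun n x _ y hy ↦ ⟨y, hy⟩, fun n y hy ↦ ⟨y, 0, hy, by rw [map_zero, add_zero]; rfl⟩⟩
    · rintro (_ | n) hn y
      · simp at hn
      obtain ⟨p, hp₁, hp₂⟩ := exists_of_prod sq subsingleton_zeroCx (n := n + 1) 0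
        ((0 : V (n + 1)), y)
      refine ⟨p, ?_⟩
      change f.hom.f _ ((pullback.fst _ _ : prodCx E (discSum V) ⟶ E).hom.f _ p) +
        θ.hom.f _ ((pullback.snd _ _ : prodCx E (discSum V) ⟶ _).hom.f _ p) = y
      rw [hp₁, hp₂, map_zero, zero_add]
      exact fromDiscSum_apply _ _ _

end Postnikov

/-! ### Towers built from successive improvements -/

namespace Postnikov

variable {k : Type u} [Field k]

/-- The map `g` is bijective in degree `i`. -/
abbrev BijAt {K L : ChFin k} (g : K ⟶ L) (i : ℕ) : Prop := Function.Bijective (g.hom.f i)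

/-- A numerical measure of the complexity of `g` in degree `i`. -/
def complexity {K L : ChFin k} (g : K ⟶ L) (i : ℕ) : ℕ :=
  -- Attaching a disc can raise the dimension of the target by one while lowering that of the kernel
  -- by at least one; the weight `2` makes the total drop.
  2 * Module.finrank k (LinearMap.ker (g.hom.f i).hom) + Module.finrank k (L.obj.X i)

/-- The map `g` fails to be bijective in infinitely many degrees. -/
def InfinitelyBad {K L : ChFin k} (g : K ⟶ L) : Prop := ∀ N, ∃ i, N ≤ i ∧ ¬ BijAt g i

/-- The factorization `g = g' ≫ t` improves the lowest degree in which `g` is not bijective. -/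
def Improves {E Y Y' : ChFin k} (g : E ⟶ Y) (g' : E ⟶ Y') (t : Y' ⟶ Y) : Prop :=
  ∃ n, ¬ BijAt g n ∧ (∀ i < n, BijAt g i) ∧ (∀ i, i ≠ n → i ≠ n + 1 → BijAt t i) ∧
    (∀ i, complexity g' i ≤ complexity g i) ∧ ∃ j, j ≤ n + 1 ∧ complexity g' j < complexity g j

/-- Every map in `R` with infinitely many bad degrees can be improved by a pullback of a
map in `P`. -/
def HasImprovements (P R : MorphismProperty (ChFin k)) : Prop :=
  ∀ ⦃E Y : ChFin k⦄ (g : E ⟶ Y), R g → InfinitelyBad g →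
    ∃ (Y' : ChFin k) (g' : E ⟶ Y') (t : Y' ⟶ Y),
      g' ≫ t = g ∧ P.pullbacks t ∧ R g' ∧ Improves g g' t

lemma bijAt_iff_of_fac {E Y Y' : ChFin k} {g : E ⟶ Y} {g' : E ⟶ Y'} {t : Y' ⟶ Y}
    (fac : g' ≫ t = g) {i : ℕ} (ht : BijAt t i) : BijAt g i ↔ BijAt g' i := by
  subst fac
  exact Function.Bijective.of_comp_iff' ht (g'.hom.f i)

lemma InfinitelyBad.of_improves {E Y Y' : ChFin k} {g : E ⟶ Y} {g' : E ⟶ Y'} {t : Y' ⟶ Y}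
    (fac : g' ≫ t = g) (hg : InfinitelyBad g) (h : Improves g g' t) : InfinitelyBad g' := by
  obtain ⟨n, -, -, h, -⟩ := h
  intro N
  obtain ⟨i, hi, hi'⟩ := hg (max N (n + 2))
  exact ⟨i, by omega, fun hi'' ↦ hi' ((bijAt_iff_of_fac fac (h i (by omega) (by omega))).2 hi'')⟩

lemma Improves.bijAt {E Y Y' : ChFin k} {g : E ⟶ Y} {g' : E ⟶ Y'} {t : Y' ⟶ Y}
    (fac : g' ≫ t = g) (h : Improves g g' t) {N : ℕ} (hN : ∀ i ≤ N, BijAt g i) (i : ℕ)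
    (hi : i ≤ N) : BijAt g' i := by
  obtain ⟨n, h₁, -, h₂, -⟩ := h
  have hn : N < n := by
    by_contra! hn
    exact h₁ (hN n hn)
  exact (bijAt_iff_of_fac fac (h₂ i (by omega) (by omega))).1 (hN i hi)

/-- If some degree at most `N` is bad, the lowest bad degree `n` is at most `N`, and the drop occurs
in degree at most `n + 1`; hence the sum runs up to `N + 1`. -/
lemma Improves.sum_lt {E Y Y' : ChFin k} {g : E ⟶ Y} {g' : E ⟶ Y'} {t : Y' ⟶ Y}
    (h : Improves g g' t) {N : ℕ} (hN : ¬ ∀ i ≤ N, BijAt g i) :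
    ∑ i ∈ Finset.range (N + 2), complexity g' i < ∑ i ∈ Finset.range (N + 2), complexity g i := by
  obtain ⟨n, -, h₁, -, h₂, j, hj, hj'⟩ := h
  push Not at hN
  obtain ⟨i, hi, hi'⟩ := hN
  have hn : n ≤ i := by
    by_contra! hn
    exact hi' (h₁ i hn)
  exact Finset.sum_lt_sum (fun i _ ↦ h₂ i) ⟨j, by simp; omega, hj'⟩

section Sequence

variable {E : ChFin k} {Y : ℕ → ChFin k} {g : ∀ m, E ⟶ Y m} {t : ∀ m, Y (m + 1) ⟶ Y m}
  (fac : ∀ m, g (m + 1) ≫ t m = g m)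

include fac in
/-- The limit of a tower of complexes under `E`. -/
lemma transfiniteCompositionOfShape_of_sequence {P : MorphismProperty (ChFin k)}
    (ht : ∀ m, P (t m)) (hg : ∀ i, ∃ M, ∀ m, M ≤ m → BijAt (g m) i) :
    P.op.transfiniteCompositionsOfShape ℕ (g 0).op := by
  let F : ℕ ⥤ (ChFin k)ᵒᵖ := Functor.ofSequence (fun m ↦ (t m).op)
  let incl : F ⟶ (Functor.const _).obj (Opposite.op E) :=
    NatTrans.ofSequence (fun m ↦ (g m).op) (fun m ↦ by
      rw [Functor.ofSequence_map_homOfLE_succ]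
      exact (congr_arg Quiver.Hom.op (fac m)).trans (Category.comp_id _).symm)
  refine ⟨{ F := F, isoBot := Iso.refl _, incl := incl, isColimit := ?_,
            fac := Category.id_comp _, map_mem := fun m _ ↦ ?_ }⟩
  -- The limit is tested degreewise in all chain complexes. In degree `i`, the maps from `E` are
  -- isomorphisms from stage `M` on, hence so are the transition maps between these stages.
  · refine isColimitOfConeLeftOpOfCocone _ (isLimitOfReflects (degreewiseFinite k).ι
      (HomologicalComplex.isLimitOfEval _ _ fun i ↦ ?_))
    let M := (hg i).choose
    have hiso (m) (hm : M ≤ m) : IsIso ((evalDeg k i).map (g m)) :=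
      (ConcreteCategory.isIso_iff_bijective _).2 ((hg i).choose_spec m hm)
    refine @Functor.IsEventuallyConstantTo.isLimitOfIsIso _ _ _ _ _ (Opposite.op M) ?_ _ _
      (hiso M le_rfl)
    intro j φ
    have h₁ := hiso M le_rfl
    have h₂ := hiso j.unop (leOfHom φ.unop)
    let ψ : Y j.unop ⟶ Y M := F.leftOp.map φ
    have hψ : g j.unop ≫ ψ = g M :=
      (congr_arg Quiver.Hom.unop (incl.naturality φ.unop)).trans (Category.id_comp _)
    have : (evalDeg k i).map (g j.unop) ≫ (evalDeg k i).map ψ = (evalDeg k i).map (g M) := by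
      rw [← Functor.map_comp, hψ]
    exact @IsIso.of_isIso_fac_left _ _ _ _ _ _ _ _ h₂ h₁ this
  · have : F.map (homOfLE (Order.le_succ m)) = (t m).op :=
      Functor.ofSequence_map_homOfLE_succ _ m
    rw [this]
    exact ht m

include fac in
-- The total complexity up to degree `N + 1` cannot drop forever, and bijectivity in all degrees up
-- to `N`, once reached, persists.
lemma eventually_bijAt (h : ∀ m, Improves (g m) (g (m + 1)) (t m)) (N : ℕ) :
    ∃ M, ∀ m, M ≤ m → ∀ i ≤ N, BijAt (g m) i := by
  suffices ∀ s m, ∑ i ∈ Finset.range (N + 2), complexity (g m) i < s →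
      ∃ M, ∀ i ≤ N, BijAt (g M) i by
    obtain ⟨M, hM⟩ := this _ 0 (Nat.lt_succ_self _)
    exact ⟨M, fun m hm ↦ Nat.le_induction hM (fun m _ hm ↦ (h m).bijAt (fac m) hm) m hm⟩
  intro s
  induction s with
  | zero => intro m hm; omega
  | succ s hs =>
    intro m hm
    by_cases hN : ∀ i ≤ N, BijAt (g m) i
    · exact ⟨m, hN⟩
    · exact hs (m + 1) (by have := (h m).sum_lt hN; omega)

end Sequence

/-- A factorization of a map by a map in `R` with infinitely many bad degrees. -/
structure Stage (R : MorphismProperty (ChFin k)) (E : ChFin k) where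
  /-- the target of the map -/
  Y : ChFin k
  /-- the map -/
  g : E ⟶ Y
  mem : R g
  bad : InfinitelyBad g

lemma transfiniteCompositions_le_towers {C : Type u} [Category.{v} C] {P : MorphismProperty C}
    {X Y : C} (f : X ⟶ Y) (hf : P.pullbacks.op.transfiniteCompositionsOfShape ℕ f.op) :
    towers.{w} P f := by
  rw [MorphismProperty.transfiniteCompositionsOfShape_eq_of_orderIso _
    (orderIsoShrink.{w} ℕ)] at hf
  exact MorphismProperty.transfiniteCompositionsOfShape_le_transfiniteCompositions _ _ _ hf

/-- An improvement affects bijectivity in at most two degrees, so the map stays infinitely bad and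
the improvement can be iterated along `ℕ`. -/
lemma HasImprovements.towers_of_infinitelyBad {P R : MorphismProperty (ChFin k)}
    (h : HasImprovements P R) {E B : ChFin k} (p : E ⟶ B) (hp : R p) (hp' : InfinitelyBad p) :
    towers.{w} P p := by
  choose Y' g' t fac ht hR himp using @h
  let next (s : Stage R E) : Stage R E :=
    ⟨Y' s.g s.mem s.bad, g' s.g s.mem s.bad, hR _ _ _,
      s.bad.of_improves (fac _ _ _) (himp _ _ _)⟩
  let s (m : ℕ) : Stage R E := next^[m] ⟨B, p, hp, hp'⟩
  have hs (m) : s (m + 1) = next (s m) := Function.iterate_succ_apply' _ _ _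
  have hτ (m) : ∃ τ : (s (m + 1)).Y ⟶ (s m).Y, (s (m + 1)).g ≫ τ = (s m).g ∧ P.pullbacks τ ∧
      Improves (s m).g (s (m + 1)).g τ := by
    rw [hs]
    exact ⟨_, fac _ _ _, ht _ _ _, himp _ _ _⟩
  choose τ hτ₁ hτ₂ hτ₃ using hτ
  refine transfiniteCompositions_le_towers p
    (transfiniteCompositionOfShape_of_sequence (g := fun m ↦ (s m).g) hτ₁ hτ₂ fun i ↦ ?_)
  obtain ⟨M, hM⟩ := eventually_bijAt hτ₁ hτ₃ i
  exact ⟨M, fun m hm ↦ hM m hm i le_rfl⟩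

/-- If `R` is stable under precomposition with trivial fibrations, then maps in `R` are
retracts of towers as soon as bad maps can be improved. -/
lemma HasImprovements.le_retracts_towers {P R : MorphismProperty (ChFin k)}
    (h : HasImprovements P R)
    (hR : ∀ ⦃K E B : ChFin k⦄ (q : K ⟶ E) (p : E ⟶ B),
      (∀ i, Function.Surjective (q.hom.f i)) → weq k q → R p → R (q ≫ p)) :
    R ≤ (towers.{w} P).retracts := by
  intro E B p hp
  -- With one disc of each dimension, the projection `q` has a nonzero kernel in every degree, while
  -- the zero section makes `p` a retract of `q ≫ p`.
  let V (_ : ℕ) : ModuleCat.{u} k := ModuleCat.of k k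
  have hV (n) : Module.Finite k (V n) := inferInstanceAs (Module.Finite k k)
  have sq := isPullback_prodCx E (discSum V)
  let q : prodCx E (discSum V) ⟶ E := pullback.fst _ _
  have hq : liftProd (𝟙 E) 0 ≫ q = 𝟙 E := pullback.lift_fst _ _ _
  refine ⟨_, _, q ≫ p, ⟨Arrow.homMk (liftProd (𝟙 E) 0) (𝟙 B) ?_, Arrow.homMk q (𝟙 B) ?_, ?_⟩,
    h.towers_of_infinitelyBad _ (hR q p ?_ ?_ hp) ?_⟩
  · change liftProd (𝟙 E) 0 ≫ q ≫ p = p ≫ 𝟙 B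
    rw [reassoc_of% hq, Category.comp_id]
  · exact (Category.comp_id _).symm
  · exact Arrow.hom_ext _ _ hq (Category.comp_id _)
  · intro i x
    obtain ⟨y, hy, -⟩ := exists_of_prod sq subsingleton_zeroCx x 0
    exact ⟨y, hy⟩
  · exact weq_of_prod sq subsingleton_zeroCx (isAcyclic_discSum V)
  · refine fun N ↦ ⟨N, le_rfl, fun hN ↦ ?_⟩
    obtain ⟨y, hy₁, hy₂⟩ := exists_of_prod sq subsingleton_zeroCx (0 : E.obj.X N)
      ((1 : k), (0 : shiftUp V N))
    have hy : y = 0 := hN.1 (by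
      rw [comp_apply, hy₁, map_zero, map_zero])
    subst hy
    rw [map_zero] at hy₂
    exact zero_ne_one (congr_arg Prod.fst hy₂)

end Postnikov

/-! ### Existence of improvements -/

namespace Postnikov

variable {k : Type u} [Field k]

section Pullback

variable {E P Y D S : ChFin k} {fst : P ⟶ Y} {snd : P ⟶ D} {h : Y ⟶ S} {c : D ⟶ S}

lemma bijAt_fst_of_isPullback (sq : IsPullback fst snd h c) {i : ℕ} (hc : BijAt c i) :
    BijAt fst i := by
  constructor
  · intro p p' hp
    refine ext_of_isPullback sq hp (hc.1 ?_)
    rw [← comp_apply, ← comp_apply, ← sq.w, comp_apply, comp_apply, hp]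
  · intro y
    obtain ⟨d, hd⟩ := hc.2 (h.hom.f i y)
    obtain ⟨p, hp, -⟩ := exists_of_isPullback sq y d hd.symm
    exact ⟨p, hp⟩

lemma finrank_le_of_isPullback (sq : IsPullback fst snd h c) (i : ℕ) :
    Module.finrank k (P.obj.X i) ≤ Module.finrank k (Y.obj.X i) + Module.finrank k (D.obj.X i) := by
  rw [← Module.finrank_prod]
  refine LinearMap.finrank_le_finrank_of_injective
    (f := (fst.hom.f i).hom.prod (snd.hom.f i).hom) fun p p' hp ↦ ?_
  exact ext_of_isPullback sq (congr_arg Prod.fst hp) (congr_arg Prod.snd hp)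

variable {g : E ⟶ Y} {g' : E ⟶ P} (fac : g' ≫ fst = g)

include fac

lemma ker_le_of_fac (i : ℕ) : LinearMap.ker (g'.hom.f i).hom ≤ LinearMap.ker (g.hom.f i).hom := by
  intro x hx
  replace hx : g'.hom.f i x = 0 := hx
  change g.hom.f i x = 0
  rw [← comp_eq_apply fac, hx, map_zero]

lemma complexity_le {i : ℕ} (hi : BijAt fst i) : complexity g' i ≤ complexity g i := by
  have h₁ := Submodule.finrank_mono (ker_le_of_fac fac i)
  have h₂ := LinearMap.finrank_le_finrank_of_injective (f := (fst.hom.f i).hom) hi.1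
  unfold complexity
  omega

lemma complexity_lt_of_finrank_lt {i : ℕ}
    (hi : Module.finrank k (P.obj.X i) < Module.finrank k (Y.obj.X i)) :
    complexity g' i < complexity g i := by
  have h₁ := Submodule.finrank_mono (ker_le_of_fac fac i)
  unfold complexity
  omega

lemma complexity_lt_of_ker {i : ℕ}
    (hi : Module.finrank k (P.obj.X i) ≤ Module.finrank k (Y.obj.X i) + 1)
    (x : E.obj.X i) (hx : g.hom.f i x = 0) (hx' : g'.hom.f i x ≠ 0) :
    complexity g' i < complexity g i := by
  have h₁ : LinearMap.ker (g'.hom.f i).hom < LinearMap.ker (g.hom.f i).hom :=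
    lt_of_le_of_ne (ker_le_of_fac fac i) fun h ↦ by
      have : x ∈ LinearMap.ker (g.hom.f i).hom := hx
      rw [← h] at this
      exact hx' this
  have h₂ := Submodule.finrank_lt_finrank_of_lt h₁
  unfold complexity
  omega

end Pullback

lemma bijAt_discToSphere {n i : ℕ} (hi : i ≠ n) : BijAt (discToSphere k n) i := by
  by_cases hi' : i = n + 1
  · subst hi'
    have : ⇑((discToSphere k n).hom.f (n + 1)) =
        (sphereCoord k (n + 1)).symm ∘ discTop k n := by
      ext x
      rw [Function.comp_apply, ← sphereCoord_discToSphere, LinearEquiv.symm_apply_apply]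
    change Function.Bijective _
    rw [this]
    exact (LinearEquiv.bijective _).comp (LinearEquiv.bijective _)
  · have h₁ := subsingleton_disc (k := k) hi' hi
    have h₂ := subsingleton_sphere (k := k) hi'
    exact ⟨fun x y _ ↦ Subsingleton.elim _ _, fun x ↦ ⟨0, Subsingleton.elim _ _⟩⟩

lemma finrank_disc_le (n i : ℕ) : Module.finrank k ((disc k n).obj.X i) ≤ 1 := by
  by_cases hi : i = n
  · subst hi
    rw [(discBot k i).finrank_eq, Module.finrank_self]
  · by_cases hi' : i = n + 1
    · subst hi'
      rw [(discTop k n).finrank_eq, Module.finrank_self]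
    · have := subsingleton_disc (k := k) hi' hi
      rw [Module.finrank_zero_of_subsingleton]
      exact zero_le_one

section Fibrations

variable {E Y : ChFin k} {g : E ⟶ Y}

/-- Cutting down the degree zero part of the target of a map that is not surjective. -/
lemma exists_improvement_of_not_surjective (hg : fib k g)
    (h₀ : ¬ Function.Surjective (g.hom.f 0)) :
    ∃ (Y' : ChFin k) (g' : E ⟶ Y') (t : Y' ⟶ Y),
      g' ≫ t = g ∧ (genFib k).pullbacks t ∧ fib k g' ∧ Improves g g' t := by
  -- A nonzero form vanishing on the image of `g` also vanishes on boundaries, since `g` is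
  -- surjective in degree `1`. It defines a map to `S^0`, and pulling back `0 ⟶ S^0` cuts the target
  -- down to its kernel in degree `0`.
  obtain ⟨ψ, hψ, hψ'⟩ := Submodule.exists_le_ker_of_lt_top (LinearMap.range (g.hom.f 0).hom)
    (lt_top_iff_ne_top.2 fun h ↦ h₀ (LinearMap.range_eq_top.1 h))
  replace hψ' : ∀ x, ψ (g.hom.f 0 x) = 0 := fun x ↦ hψ' ⟨x, rfl⟩
  have hψd (y : Y.obj.X (0 + 1)) : ψ (Y.obj.d (0 + 1) 0 y) = 0 := by
    obtain ⟨x, rfl⟩ := hg 1 one_pos y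
    exact (congr_arg ψ (comm_apply g 1 0 x)).symm.trans (hψ' _)
  let s : Y ⟶ sphere k 0 := toSphere ψ hψd
  let c : zeroCx k ⟶ sphere k 0 := ObjectProperty.homMk 0
  have sq : IsPullback (pullback.fst s c) (pullback.snd s c) s c := IsPullback.of_hasPullback _ _
  have w : g ≫ s = toZeroCx E ≫ c := toSphere_ext fun x ↦
    (sphereCoord_toSphere ψ hψd _).trans ((hψ' x).trans (map_zero (sphereCoord k 0)).symm)
  have fac : sq.lift g _ w ≫ pullback.fst s c = g := sq.lift_fst _ _ _
  have hbij (i) (hi : i ≠ 0) : BijAt (pullback.fst s c) i := by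
    refine bijAt_fst_of_isPullback sq ?_
    have h₁ := subsingleton_zeroCx (k := k) i
    have h₂ := subsingleton_sphere (k := k) hi
    exact ⟨fun x y _ ↦ Subsingleton.elim _ _, fun x ↦ ⟨0, Subsingleton.elim _ _⟩⟩
  have hlt : complexity (sq.lift g _ w) 0 < complexity g 0 := by
    refine complexity_lt_of_finrank_lt fac ?_
    have hinj : Function.Injective ((pullback.fst s c).hom.f 0) := fun p p' hp ↦ by
      have := subsingleton_zeroCx (k := k) 0
      exact ext_of_isPullback sq hp (Subsingleton.elim _ _)
    rw [← LinearMap.finrank_range_of_inj (f := ((pullback.fst s c).hom.f 0).hom) hinj]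
    refine Submodule.finrank_lt fun h ↦ hψ (LinearMap.ext fun y ↦ ?_)
    obtain ⟨p, rfl⟩ := LinearMap.range_eq_top.1 h y
    refine (sphereCoord_toSphere ψ hψd _).symm.trans ?_
    refine (congr_arg (sphereCoord k 0) (comp_eq_apply sq.w 0 p)).trans ?_
    exact map_zero (sphereCoord k 0)
  refine ⟨_, _, _, fac, ⟨_, _, _, _, _, .zero, sq.flip⟩, ?_, 0, fun h ↦ h₀ h.2, by simp,
    fun i hi _ ↦ hbij i hi, ?_, 0, by omega, hlt⟩
  · intro i hi y
    obtain ⟨x, hx⟩ := hg i hi ((pullback.fst s c).hom.f i y)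
    exact ⟨x, (hbij i hi.ne').1 ((comp_eq_apply fac i x).trans hx)⟩
  · rintro (_ | i)
    · exact hlt.le
    · exact complexity_le fac (hbij _ (by simp))

/-- Enlarging the target of a surjective map by attaching a class of degree `m`. -/
lemma exists_improvement_of_cycle (hg : ∀ i, Function.Surjective (g.hom.f i))
    {n m : ℕ} (hn : ¬ BijAt g n) (hn' : ∀ i < n, BijAt g i) (hm : m = n ∨ m = n + 1)
    (x : E.obj.X m) (hx : g.hom.f m x = 0)
    (hx' : ∀ y, g.hom.f (m + 1) y = 0 → E.obj.d (m + 1) m y ≠ x) :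
    ∃ (Y' : ChFin k) (g' : E ⟶ Y') (t : Y' ⟶ Y),
      g' ≫ t = g ∧ (genFib k).pullbacks t ∧ fib k g' ∧ Improves g g' t := by
  -- The form `φ` detects `x` and kills differentials of kernel elements, so `φ ∘ d` descends along
  -- `g` to a form `ψ` on `Y`. The pair `(φ, ψ)` is a map from `g` to the generator.
  obtain ⟨φ, hφ, hφ'⟩ := Submodule.exists_le_ker_of_notMem
    (p := (LinearMap.ker (g.hom.f (m + 1)).hom).map (E.obj.d (m + 1) m).hom) (v := x) (by
      rintro ⟨y, hy, hy'⟩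
      exact hx' y hy hy')
  obtain ⟨ψ, hψ⟩ := exists_factor (g.hom.f (m + 1)).hom (φ ∘ₗ (E.obj.d (m + 1) m).hom)
    (fun y hy ↦ hφ' ⟨y, hy, rfl⟩)
  let s : Y ⟶ sphere k (m + 1) := toSphere ψ (fun y ↦ by
    obtain ⟨y, rfl⟩ := hg _ y
    refine (congr_arg ψ (comm_apply g _ _ y)).symm.trans ((hψ _).trans ?_)
    exact (congr_arg φ (d_d_apply E _ _ _ y)).trans (map_zero φ))
  let c := discToSphere k m
  have sq : IsPullback (pullback.fst s c) (pullback.snd s c) s c := IsPullback.of_hasPullback _ _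
  have w : g ≫ s = toDisc φ ≫ c := toSphere_ext fun x ↦ by
    rw [comp_apply, comp_apply, sphereCoord_discToSphere, discTop_eq, discBot_toDisc]
    exact (sphereCoord_toSphere _ _ _).trans (hψ x)
  have fac : sq.lift g _ w ≫ pullback.fst s c = g := sq.lift_fst _ _ _
  have fac' : sq.lift g _ w ≫ pullback.snd s c = toDisc φ := sq.lift_snd _ _ _
  have hbij (i) (hi : i ≠ m) : BijAt (pullback.fst s c) i :=
    bijAt_fst_of_isPullback sq (bijAt_discToSphere hi)
  have hlt : complexity (sq.lift g _ w) m < complexity g m := by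
    refine complexity_lt_of_ker fac
      ((finrank_le_of_isPullback sq m).trans (by have := finrank_disc_le (k := k) m m; omega))
      x hx fun h ↦ hφ ?_
    rw [← discBot_toDisc φ x, ← comp_eq_apply fac', h, map_zero, map_zero]
  refine ⟨_, _, _, fac, ⟨_, _, _, _, _, .disc m, sq.flip⟩, ?_, n, hn, hn',
    fun i hi hi' ↦ hbij i (by omega), ?_, m, by omega, hlt⟩
  · intro i _ y
    obtain ⟨e, he⟩ := hg i ((pullback.fst s c).hom.f i y)
    by_cases hi : i = m
    · subst hi
      let a := discBot k i ((pullback.snd s c).hom.f i y)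
      -- A multiple of `x` corrects the disc coordinate without moving the image in `Y`, as `x` lies
      -- in the kernel of `g`.
      refine ⟨e + ((a - φ e) / φ x) • x, ext_of_isPullback sq ?_ ((discBot k i).injective ?_)⟩
      · rw [comp_eq_apply fac, map_add, he, map_smul, hx, smul_zero, add_zero]
      · rw [comp_eq_apply fac', discBot_toDisc, map_add, map_smul, smul_eq_mul,
          div_mul_cancel₀ _ hφ, add_sub_cancel]
    · exact ⟨e, (hbij i hi).1 ((comp_eq_apply fac i e).trans he)⟩
  · intro i
    by_cases hi : i = m
    · subst hi
      exact hlt.le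
    · exact complexity_le fac (hbij i hi)

lemma exists_ker_of_not_bijAt {n : ℕ} (hg : Function.Surjective (g.hom.f n)) (hn : ¬ BijAt g n) :
    ∃ x, g.hom.f n x = 0 ∧ x ≠ 0 := by
  by_contra! h
  exact hn ⟨(injective_iff_map_eq_zero (g.hom.f n).hom).2 h, hg⟩

lemma exists_minimal_bad (hg : InfinitelyBad g) : ∃ n, ¬ BijAt g n ∧ ∀ i < n, BijAt g i := by
  classical
  obtain ⟨i, -, hi⟩ := hg 0
  have : ∃ n, ¬ BijAt g n := ⟨i, hi⟩
  exact ⟨Nat.find this, Nat.find_spec this, fun i hi ↦ not_not.1 (Nat.find_min this hi)⟩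

end Fibrations

/-- Once `g` is surjective, take a nonzero kernel element `x` in the lowest bad degree. Either `x`
is not the differential of a kernel element and can be used itself, or `x = d y` and `y` can be used
one degree higher: `y = d z` would give `x = 0`. -/
lemma hasImprovements_fib : HasImprovements (genFib k) (fib k) := by
  intro E Y g hg hbad
  by_cases h₀ : Function.Surjective (g.hom.f 0)
  swap
  · exact exists_improvement_of_not_surjective hg h₀
  have hs (i) : Function.Surjective (g.hom.f i) := by
    rcases i.eq_zero_or_pos with rfl | hi
    exacts [h₀, hg i hi]
  obtain ⟨n, hn, hn'⟩ := exists_minimal_bad hbad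
  obtain ⟨x, hx, hx₀⟩ := exists_ker_of_not_bijAt (hs n) hn
  by_cases hx' : ∀ y, g.hom.f (n + 1) y = 0 → E.obj.d (n + 1) n y ≠ x
  · exact exists_improvement_of_cycle hs hn hn' (Or.inl rfl) x hx hx'
  · push Not at hx'
    obtain ⟨y, hy, rfl⟩ := hx'
    refine exists_improvement_of_cycle hs hn hn' (Or.inr rfl) y hy fun z _ hz ↦ hx₀ ?_
    rw [← hz, d_d_apply]

lemma surjective_of_fib_of_weq {E Y : ChFin k} {g : E ⟶ Y} (hg : fib k g) (hg' : weq k g) (i : ℕ) :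
    Function.Surjective (g.hom.f i) := by
  rcases i.eq_zero_or_pos with rfl | hi
  · intro y
    obtain ⟨x, z, -, rfl⟩ := ((weq_iff g).1 hg').surj 0 y (by simp)
    obtain ⟨z, rfl⟩ := hg 1 one_pos z
    exact ⟨x + E.obj.d 1 0 z, by rw [map_add, comm_apply]⟩
  · exact hg i hi

/-- The kernel of `g` is acyclic, so a nonzero element `x` of it in the lowest bad degree is `d v`
with `v` in the kernel. Multiplying the target by a disc whose coordinate detects `x` makes both `x`
and `v` survive. -/
lemma hasImprovements_trivFib : HasImprovements (genTrivFib k) (fib k ⊓ weq k) := by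
  rintro E Y g ⟨hg, hw⟩ hbad
  have hs := surjective_of_fib_of_weq hg hw
  obtain ⟨n, hn, hn'⟩ := exists_minimal_bad hbad
  obtain ⟨x, hx, hx₀⟩ := exists_ker_of_not_bijAt (hs n) hn
  obtain ⟨v, hv, rfl⟩ : ∃ v, g.hom.f (n + 1) v = 0 ∧ E.obj.d (n + 1) n v = x := by
    have hw' := (weq_iff g).1 hw
    have hdx : E.obj.d n (n - 1) x = 0 := by
      cases n with
      | zero => simp
      | succ n => exact (hn' n (by omega)).1 ((comm_apply g (n + 1) n x).trans
        ((congr_arg _ hx).trans ((map_zero _).trans (map_zero (g.hom.f n).hom).symm)))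
    obtain ⟨a, rfl⟩ := hw'.inj n x hdx 0 (by rw [hx, map_zero])
    obtain ⟨z, b, hz, hb⟩ := hw'.surj (n + 1) (g.hom.f (n + 1) a) (by
      rw [Nat.add_sub_cancel, ← comm_apply, hx])
    obtain ⟨b, rfl⟩ := hs _ b
    rw [Nat.add_sub_cancel] at hz
    -- The primitive `a` of `x` need not lie in the kernel. Its image is a cycle, equal to the image
    -- of a cycle `z` plus the boundary of the image of `b`, so both are subtracted.
    refine ⟨a - z - E.obj.d _ _ b, ?_, ?_⟩
    · rw [map_sub, map_sub, ← hb, comm_apply]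
      abel
    · rw [map_sub, map_sub, hz, d_d_apply, sub_zero, sub_zero]
  obtain ⟨φ, hφ, -⟩ := Submodule.exists_le_ker_of_notMem
    (p := (⊥ : Submodule k (E.obj.X n))) (v := E.obj.d (n + 1) n v) (by simpa using hx₀)
  have sq := isPullback_prodCx Y (disc k n)
  let g' : E ⟶ prodCx Y (disc k n) := liftProd g (toDisc φ)
  let t : prodCx Y (disc k n) ⟶ Y := pullback.fst _ _
  let r : prodCx Y (disc k n) ⟶ disc k n := pullback.snd _ _
  have fac : g' ≫ t = g := pullback.lift_fst _ _ _
  have fac' : g' ≫ r = toDisc φ := pullback.lift_snd _ _ _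
  have hbij (i) (hi : i ≠ n) (hi' : i ≠ n + 1) : BijAt t i := by
    refine bijAt_fst_of_isPullback sq ?_
    have h₁ := subsingleton_zeroCx (k := k) i
    have h₂ := subsingleton_disc (k := k) hi' hi
    exact ⟨fun x y _ ↦ Subsingleton.elim _ _, fun x ↦ ⟨0, Subsingleton.elim _ _⟩⟩
  have hfin (i) : Module.finrank k ((prodCx Y (disc k n)).obj.X i) ≤
      Module.finrank k (Y.obj.X i) + 1 :=
    (finrank_le_of_isPullback sq i).trans (by have := finrank_disc_le (k := k) n i; omega)
  have hlt : complexity g' n < complexity g n := by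
    refine complexity_lt_of_ker fac (hfin n) _ hx fun h ↦ hφ ?_
    rw [← discBot_toDisc φ, ← comp_eq_apply fac', h, map_zero, map_zero]
  have hlt' : complexity g' (n + 1) < complexity g (n + 1) := by
    refine complexity_lt_of_ker fac (hfin _) v hv fun h ↦ hφ ?_
    rw [← discBot_toDisc φ, ← discTop_eq, ← comp_eq_apply fac', h, map_zero, map_zero]
  refine ⟨_, g', t, fac, ⟨_, _, _, _, _, .disc n, sq.flip⟩, ⟨?_, ?_⟩, n, hn, hn', hbij, ?_,
    n, by omega, hlt⟩
  -- In degrees `n` and `n + 1`, multiples of `d v` and of `v` adjust the disc coordinate while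
  -- leaving the image in `Y` fixed.
  · intro i _ y
    obtain ⟨e, he⟩ := hs i (t.hom.f i y)
    by_cases hi : i = n
    · subst hi
      let a := discBot k i (r.hom.f i y)
      refine ⟨e + ((a - φ e) / φ (E.obj.d (i + 1) i v)) • E.obj.d (i + 1) i v,
        ext_of_isPullback sq ?_ ((discBot k i).injective ?_)⟩
      · refine (comp_eq_apply fac _ _).trans ?_
        rw [map_add, he, map_smul, hx, smul_zero, add_zero]
      · refine (congr_arg (discBot k i) (comp_eq_apply fac' _ _)).trans ?_
        rw [discBot_toDisc, map_add, map_smul, smul_eq_mul,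
          div_mul_cancel₀ _ hφ, add_sub_cancel]
    · by_cases hi' : i = n + 1
      · subst hi'
        let a := discTop k n (r.hom.f (n + 1) y)
        refine ⟨e + ((a - φ (E.obj.d (n + 1) n e)) / φ (E.obj.d (n + 1) n v)) • v,
          ext_of_isPullback sq ?_ ((discTop k n).injective ?_)⟩
        · refine (comp_eq_apply fac _ _).trans ?_
          rw [map_add, he, map_smul, hv, smul_zero, add_zero]
        · refine (congr_arg (discTop k n) (comp_eq_apply fac' _ _)).trans ?_
          rw [discTop_eq, discBot_toDisc, map_add, map_smul, map_add, map_smul, smul_eq_mul,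
            div_mul_cancel₀ _ hφ, add_sub_cancel]
      · exact ⟨e, (hbij i hi hi').1 ((comp_eq_apply fac i e).trans he)⟩
  · refine (weq k).of_postcomp g' t
      (weq_of_prod sq subsingleton_zeroCx (isAcyclic_disc n)) ?_
    rwa [fac]
  · intro i
    by_cases hi : i = n
    · subst hi
      exact hlt.le
    · by_cases hi' : i = n + 1
      · subst hi'
        exact hlt'.le
      · exact complexity_le fac (hbij i hi hi')

end Postnikov

/-! ### Weak factorization systems and the model structure -/

namespace Postnikov

variable (k : Type u) [Field k]

lemma fib_le_retracts_towers : fib k ≤ (towers.{w} (genFib k)).retracts :=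
  hasImprovements_fib.le_retracts_towers fun _ _ _ _ _ hq _ hp i hi ↦ (hp i hi).comp (hq i)

lemma trivFib_le_retracts_towers :
    fib k ⊓ weq k ≤ (towers.{w} (genTrivFib k)).retracts :=
  hasImprovements_trivFib.le_retracts_towers fun _ _ _ _ _ hq hq' hp ↦
    ⟨fun i hi ↦ (hp.1 i hi).comp (hq i), (weq k).comp_mem _ _ hq' hp.2⟩

/-- The inclusions `R ≤ (towers P).retracts ≤ L.rlp` give the lifting axiom; the resulting
factorization system has `L.rlp = R`, which closes the chain into equalities. -/
lemma IsPresentation.of_le {C : Type u} [Category.{v} C] {L R P : MorphismProperty C}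
    [L.HasFactorization R] [L.IsStableUnderRetracts] [R.IsStableUnderRetracts]
    (h₁ : P ≤ L.rlp) (h₂ : R ≤ (towers.{w} P).retracts) : IsPresentation.{w} L R P := by
  have h₃ : (towers.{w} P).retracts ≤ L.rlp :=
    MorphismProperty.retracts_le_iff.2 (towers_le_rlp h₁)
  have wfs : L.IsWeakFactorizationSystem R :=
    .mk' _ _ fun i p hi hp ↦ h₃ _ (h₂ _ hp) _ hi
  exact ⟨wfs, le_antisymm h₂ (h₃.trans_eq wfs.rlp)⟩

lemma isPresentation_fib : IsPresentation.{w} (cof k ⊓ weq k) (fib k) (genFib k) :=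
  .of_le genFib_le_rlp (fib_le_retracts_towers k)

lemma isPresentation_trivFib : IsPresentation.{w} (cof k) (fib k ⊓ weq k) (genTrivFib k) :=
  .of_le genTrivFib_le_rlp (trivFib_le_retracts_towers k)

/-- The model category structure on degreewise finite-dimensional chain complexes. -/
@[reducible]
def modelCategory : ModelCategory (ChFin k) :=
  letI : CategoryWithFibrations (ChFin k) := ⟨fib k⟩
  letI : CategoryWithCofibrations (ChFin k) := ⟨cof k⟩
  letI : CategoryWithWeakEquivalences (ChFin k) := ⟨weq k⟩
  haveI : (weakEquivalences (ChFin k)).HasTwoOutOfThreeProperty :=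
    inferInstanceAs (weq k).HasTwoOutOfThreeProperty
  haveI : (cofibrations (ChFin k)).IsWeakFactorizationSystem (trivialFibrations (ChFin k)) :=
    (isPresentation_trivFib.{0} k).isWeakFactorizationSystem
  haveI : (trivialCofibrations (ChFin k)).IsWeakFactorizationSystem (fibrations (ChFin k)) :=
    (isPresentation_fib.{0} k).isWeakFactorizationSystem
  ModelCategory.mk' (ChFin k)

end Postnikov

end

theorem theorem3p1 (k : Type u) [Field k] :
    ∃ _ : ModelCategory (Postnikov.ChFin k),
      cofibrations (Postnikov.ChFin k) = Postnikov.cof k ∧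
      fibrations (Postnikov.ChFin k) = Postnikov.fib k ∧
      weakEquivalences (Postnikov.ChFin k) = Postnikov.weq k ∧
      Postnikov.IsModelPresentation.{w} (Postnikov.ChFin k)
        (Postnikov.genFib k) (Postnikov.genTrivFib k) := by
  let := Postnikov.modelCategory k
  exact ⟨this, rfl, rfl, rfl,
    ⟨Postnikov.isPresentation_fib.{w} k, Postnikov.isPresentation_trivFib.{w} k⟩⟩
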